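/- Let $X_1,X_2,\dots$ be a (strictly) stationary sequence of real random variables, and let $M_n=\max_{1\le j\le n}X_j$. A distribution function $G$ on $\mathbb R$ is a \emph{phantom distribution function} of $(X_j)$ if $P(M_n\le u_n)-G(u_n)^n\to 0$ for every real sequence $(u_n)$. Put $G_*=\sup\{x: G(x)<1\}\in(-\infty,+\infty]$; $G$ is \emph{regular} if $$G(G_*-)=1\quad\text{and}\quad \lim_{x\to G_*-}\frac{1-G(x-)}{1-G(x)}=1 .$$ For a real sequence $(v_n)_{n\ge1}$ and $T\in(0,\infty)$, Condition $B_T(v_n)$ says that $$\sup_{p,q\ge 1,\ p+q\le Tn}\bigl|P(M_{p+q}\le v_n)-P(M_p\le v_n)P(M_q\le v_n)\bigr|\to0\qquad(n\to\infty),$$ and Condition $B_\infty(v_n)$ says the same with the supremum over all integers $p,q\ge1$. \textbf{Theorem.} The following are equivalent: (i) $(X_j)$ admits a continuous phantom distribution function. (ii) $(X_j)$ admits a regular phantom distribution function. (iii) There are a real sequence $(v_n)$ and $\gamma\in(0,1)$ such that $P(M_n\le v_n)\to\gamma$ and Condition $B_\infty(v_n)$ holds. (iv) There are a real sequence $(v_n)$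 and $\gamma\in(0,1)$ such that $P(M_n\le v_n)\to\gamma$ and Condition $B_T(v_n)$ holds for each $T>0$. (v) There are a real sequence $(v_n)$, $\gamma\in(0,1)$ and a dense subset $Q$ of $(0,\infty)$ such that $P(M_{[nt]}\le v_n)\to\gamma^t$ for every $t\in Q$. Moreover, let $\gamma\in(0,1)$ and $(v_n)_{n\ge1}$ be as in (iii), (iv) or (v). If $(v_n)$ is strictly increasing, then $G(x)=\gamma^{g(x)}$ is a continuous phantom distribution function of $(X_j)$, where $$g(x)=\begin{cases} v_1-x+1, & x<v_1,\\[2pt] \dfrac{-x+(n+1)v_{n+1}-nv_n}{n(n+1)(v_{n+1}-v_n)}, & v_n\le x<v_{n+1},\\[2pt] 0, & x\ge\sup_n v_n.\end{cases}$$ If $(v_n)$ is only non-decreasing, then the set $\{n\ge 1: v_n<v_{n+1}\}$ is infinite and, with $p_1<p_2<\cdots$ its elements, $G(x)=\gamma^{g(x)}$ is a continuous phantom distribution function of $(X_j)$, where $$g(x)=\begin{cases} v_{p_1}-x+1/p_1, & x<v_{p_1},\\[2pt] \dfrac1{p_k}+\Bigl(\dfrac1{p_{k+1}}-\dfrac1{p_k}\Bigr)\dfrac{x-v_{p_k}}{v_{p_{k+1}}-v_{p_k}},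 & v_{p_k}\le x<v_{p_{k+1}},\\[2pt] 0, & x\ge\sup_n v_n.\end{cases}$$ -/

import Mathlib

open MeasureTheory Filter Topology

namespace PhantomDF

/-- A sequence `X 0, X 1, X 2, …` of random variables is (strictly) stationary under `P` if every
shift of the sequence has the same law, as a random element of `ℕ → ℝ`.  Throughout, the random
variable usually written `X_j`, `j = 1, 2, …`, is `X (j - 1)`. -/
def IsStationary {Ω : Type*} [MeasurableSpace Ω] (P : Measure Ω) (X : ℕ → Ω → ℝ) : Prop :=
  ∀ k : ℕ, P.map (fun ω (i : ℕ) => X (i + k) ω) = P.map (fun ω (i : ℕ) => X i ω)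

/-- The partial maximum `M_n` of the first `n` variables of the sequence
(with `M_0 = -∞`, the maximum of the empty family). -/
noncomputable def partialMax {Ω : Type*} (X : ℕ → Ω → ℝ) (n : ℕ) (ω : Ω) : EReal :=
  (Finset.range n).sup (fun i => (X i ω : EReal))

/-- `P(M_n ≤ u)`. -/
noncomputable def maxProb {Ω : Type*} [MeasurableSpace Ω] (P : Measure Ω) (X : ℕ → Ω → ℝ)
    (n : ℕ) (u : ℝ) : ℝ :=
  P.real {ω | partialMax X n ω ≤ (u : EReal)}

/-- Distribution functions of probability measures on the real line. -/
structure IsDistributionFunction (G : ℝ → ℝ) : Prop where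
  monotone : Monotone G
  rightContinuous : ∀ x, ContinuousWithinAt G (Set.Ici x) x
  tendsto_atBot : Tendsto G atBot (𝓝 0)
  tendsto_atTop : Tendsto G atTop (𝓝 1)

/-- `G` is a phantom distribution function of the sequence `X`:
`P(M_n ≤ u_n) - G(u_n)^n → 0` for every sequence of reals `u_n`. -/
structure IsPhantom {Ω : Type*} [MeasurableSpace Ω] (P : Measure Ω) (X : ℕ → Ω → ℝ)
    (G : ℝ → ℝ) : Prop where
  isDistributionFunction : IsDistributionFunction G
  tendsto_sub : ∀ u : ℕ → ℝ,
    Tendsto (fun n => maxProb P X n (u n) - G (u n) ^ n) atTop (𝓝 0)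

/-- The right end `G_* = sup {x | G x < 1}`, possibly `+∞`. -/
noncomputable def rightEnd (G : ℝ → ℝ) : EReal :=
  sSup ((fun x : ℝ => (x : EReal)) '' {x | G x < 1})

/-- The filter `x → G_*-` on the real line (real `x < G_*` approaching `G_*`). -/
noncomputable def toRightEnd (G : ℝ → ℝ) : Filter ℝ :=
  comap (fun x : ℝ => (x : EReal)) (𝓝[<] (rightEnd G))

/-- Regularity in the sense of O'Brien: `G(G_*-) = 1` and
`(1 - G(x-)) / (1 - G(x)) → 1` as `x → G_*-`. -/
structure IsRegular (G : ℝ → ℝ) : Prop where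
  tendsto_one : Tendsto G (toRightEnd G) (𝓝 1)
  tendsto_ratio :
    Tendsto (fun x => (1 - Function.leftLim G x) / (1 - G x)) (toRightEnd G) (𝓝 1)

/-- Condition `B_∞(v_n)`: the supremum over `p, q ≥ 1` of
`|P(M_{p+q} ≤ v_n) - P(M_p ≤ v_n) P(M_q ≤ v_n)|` tends to `0` as `n → ∞`. -/
def CondBInf {Ω : Type*} [MeasurableSpace Ω] (P : Measure Ω) (X : ℕ → Ω → ℝ)
    (v : ℕ → ℝ) : Prop :=
  ∀ ε : ℝ, 0 < ε → ∀ᶠ n : ℕ in atTop, ∀ p q : ℕ, 1 ≤ p → 1 ≤ q →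
    |maxProb P X (p + q) (v n) - maxProb P X p (v n) * maxProb P X q (v n)| ≤ ε

/-- Condition `B_T(v_n)`: as `B_∞(v_n)`, with the supremum restricted to `p + q ≤ T n`. -/
def CondB {Ω : Type*} [MeasurableSpace Ω] (P : Measure Ω) (X : ℕ → Ω → ℝ)
    (T : ℝ) (v : ℕ → ℝ) : Prop :=
  ∀ ε : ℝ, 0 < ε → ∀ᶠ n : ℕ in atTop, ∀ p q : ℕ, 1 ≤ p → 1 ≤ q →
    ((p + q : ℕ) : ℝ) ≤ T * (n : ℝ) →
    |maxProb P X (p + q) (v n) - maxProb P X p (v n) * maxProb P X q (v n)| ≤ ε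

/-- `P(M_n ≤ v_n) → γ` and Condition `B_∞(v_n)` holds. -/
def LevelsBInf {Ω : Type*} [MeasurableSpace Ω] (P : Measure Ω) (X : ℕ → Ω → ℝ)
    (γ : ℝ) (v : ℕ → ℝ) : Prop :=
  Tendsto (fun n => maxProb P X n (v n)) atTop (𝓝 γ) ∧ CondBInf P X v

/-- `P(M_n ≤ v_n) → γ` and Condition `B_T(v_n)` holds for each `T > 0`. -/
def LevelsB {Ω : Type*} [MeasurableSpace Ω] (P : Measure Ω) (X : ℕ → Ω → ℝ)
    (γ : ℝ) (v : ℕ → ℝ) : Prop :=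
  Tendsto (fun n => maxProb P X n (v n)) atTop (𝓝 γ) ∧ ∀ T : ℝ, 0 < T → CondB P X T v

/-- `P(M_[nt] ≤ v_n) → γ ^ t` for all `t` in some dense subset of `(0, ∞)`. -/
def LevelsDense {Ω : Type*} [MeasurableSpace Ω] (P : Measure Ω) (X : ℕ → Ω → ℝ)
    (γ : ℝ) (v : ℕ → ℝ) : Prop :=
  ∃ Q : Set ℝ, Q ⊆ Set.Ioi 0 ∧ Set.Ioi 0 ⊆ closure Q ∧ ∀ t ∈ Q,
    Tendsto (fun n : ℕ => maxProb P X ⌊(n : ℝ) * t⌋₊ (v n)) atTop (𝓝 (γ ^ t))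

open Classical in
/-- The exponent `g` for a strictly increasing sequence `v 1 < v 2 < …` (the value `v 0` is not
used).  In the last case `n` is the index with `v n ≤ x < v (n + 1)`. -/
noncomputable def exponentStrict (v : ℕ → ℝ) (x : ℝ) : ℝ :=
  if x < v 1 then v 1 - x + 1
  else if ∀ n, 1 ≤ n → v n ≤ x then 0
  else
    let n : ℕ := sSup {n | 1 ≤ n ∧ v n ≤ x}
    (-x + ((n : ℝ) + 1) * v (n + 1) - (n : ℝ) * v n) /
      ((n : ℝ) * ((n : ℝ) + 1) * (v (n + 1) - v n))

/-- The indices `n ≥ 1` at which the sequence `v 1 ≤ v 2 ≤ …` increases strictly. -/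
def jumpIndices (v : ℕ → ℝ) : Set ℕ := {n | 1 ≤ n ∧ v n < v (n + 1)}

/-- `jumpIndex v 0 < jumpIndex v 1 < …` enumerates `jumpIndices v` when this set is infinite;
thus `v` is constant on `{1, …, jumpIndex v 0}` and on every block
`{jumpIndex v k + 1, …, jumpIndex v (k + 1)}`. -/
noncomputable def jumpIndex (v : ℕ → ℝ) (k : ℕ) : ℕ := Nat.nth (fun n => n ∈ jumpIndices v) k

open Classical in
/-- The exponent `g` for a non-decreasing sequence `v 1 ≤ v 2 ≤ …` with infinitely many jumps
`p 0 < p 1 < …`: it is `1 / p k` at `v (p k)`, linear between `v (p k)` and `v (p (k + 1))`,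
`v (p 0) - x + 1 / p 0` to the left of `v (p 0)`, and `0` from `sup v` on.  In the last case `k` is
the index with `v (p k) ≤ x < v (p (k + 1))`. -/
noncomputable def exponentMono (v : ℕ → ℝ) (x : ℝ) : ℝ :=
  let p : ℕ → ℕ := jumpIndex v
  if x < v (p 0) then v (p 0) - x + 1 / (p 0 : ℝ)
  else if ∀ n, 1 ≤ n → v n ≤ x then 0
  else
    let k : ℕ := sSup {k | v (p k) ≤ x}
    1 / (p k : ℝ) + (1 / (p (k + 1) : ℝ) - 1 / (p k : ℝ)) *
      ((x - v (p k)) / (v (p (k + 1)) - v (p k)))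

end PhantomDF

/-! By stationarity `n ↦ P(M_n ≤ u)` is convex (`maxProb_convex`), so changing `n` by a bounded
amount is negligible, uniformly in `u`. Hence under `B_T` a maximum over `n` splits into `b` blocks
of length about `n / b`, and regrouping `a` of them gives `γ ^ (a / b)`: levels with mixing give
levels on a dense set (`LevelsB.levelsDense`).

Monotonicity in the index extends this limit to every `t > 0`. Then `P(M_n ≤ v_⌊n/s⌋) → γ ^ s`, so
the levels `v_⌊n/s⌋`, `s > 0`, calibrate all values in `(0, 1)`. Any distribution function `γ ^ g`
with `g` close to `1 / m` near `v_m` takes asymptotically the same values there, and is therefore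
phantom (`LevelsDense.isPhantom_rpow`). The interpolated `g` qualifies because constancy blocks of
`v` have end-to-start ratio tending to `1`. Non-monotone levels are first replaced by quantiles of
the maxima.

Conversely, a regular phantom `G` has quantiles with `G(v_n) ^ n → γ`. Convergence to `G ^ n` is
uniform in the level, so `G ^ (p + q) = G ^ p * G ^ q` yields `B_∞` for long blocks, while short
blocks have maxima below `v_n` with probability near `1`. -/

namespace PhantomDF

/-! ### Maxima of a stationary sequence: convexity in the number of variables. -/

section MaxProb

variable {Ω : Type*} [MeasurableSpace Ω] {P : Measure Ω} {X : ℕ → Ω → ℝ}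

lemma maxProb_eq (n : ℕ) (u : ℝ) : maxProb P X n u = P.real {ω | ∀ i < n, X i ω ≤ u} := by
  simp [maxProb, partialMax, Finset.sup_le_iff]

lemma maxProb_nonneg (n : ℕ) (u : ℝ) : 0 ≤ maxProb P X n u := measureReal_nonneg

lemma measurableSet_maxLe (hX : ∀ i, Measurable (X i)) (n : ℕ) (u : ℝ) :
    MeasurableSet {ω | ∀ i < n, X i ω ≤ u} := by
  have : {ω | ∀ i < n, X i ω ≤ u} = ⋂ i, ⋂ (_ : i < n), {ω | X i ω ≤ u} := by
    ext; simp
  rw [this]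
  exact .iInter fun i => .iInter fun _ => measurableSet_le (hX i) measurable_const

lemma maxProb_shift (hX : ∀ i, Measurable (X i)) (hs : IsStationary P X) (k n : ℕ) (u : ℝ) :
    P.real {ω | ∀ i < n, X (i + k) ω ≤ u} = maxProb P X n u := by
  have hS : MeasurableSet {f : ℕ → ℝ | ∀ i < n, f i ≤ u} :=
    measurableSet_maxLe (X := fun i (f : ℕ → ℝ) => f i) (fun i => measurable_pi_apply i) n u
  have h := congrArg (fun μ => μ.real {f : ℕ → ℝ | ∀ i < n, f i ≤ u}) (hs k)
  beta_reduce at h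
  rw [map_measureReal_apply (measurable_pi_lambda _ fun i => hX _) hS,
    map_measureReal_apply (measurable_pi_lambda _ fun i => hX _) hS] at h
  rw [maxProb_eq]
  exact h

variable [IsProbabilityMeasure P]

lemma maxProb_le_one (n : ℕ) (u : ℝ) : maxProb P X n u ≤ 1 := measureReal_le_one

lemma maxProb_zero (u : ℝ) : maxProb P X 0 u = 1 := by
  simp [maxProb_eq]

lemma maxProb_antitone (u : ℝ) : Antitone fun n => maxProb P X n u := by
  intro m n h
  simp only [maxProb_eq]
  exact measureReal_mono fun ω hω i hi => hω i (hi.trans_le h)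

lemma maxProb_mono (n : ℕ) : Monotone (maxProb P X n) := by
  intro u w h
  simp only [maxProb_eq]
  exact measureReal_mono fun ω hω i hi => (hω i hi).trans h

/-- For a stationary sequence, `n ↦ P(M_n ≤ u)` is convex. -/
lemma maxProb_convex (hX : ∀ i, Measurable (X i)) (hs : IsStationary P X) (n : ℕ) (u : ℝ) :
    2 * maxProb P X (n + 1) u ≤ maxProb P X n u + maxProb P X (n + 2) u := by
  -- Inclusion–exclusion for two overlapping windows of length `n + 1`: the intersection covers `n +
  -- 2` variables, and the union forces the `n` shared ones below `u`.
  set A := {ω | ∀ i < n + 1, X i ω ≤ u} with hA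
  set B := {ω | ∀ i < n + 1, X (i + 1) ω ≤ u} with hB
  have h1 : P.real A = maxProb P X (n + 1) u := (maxProb_eq _ _).symm
  have h2 : P.real B = maxProb P X (n + 1) u := maxProb_shift hX hs 1 _ _
  have h3 : P.real (A ∩ B) = maxProb P X (n + 2) u := by
    rw [maxProb_eq]
    congr 1
    ext ω
    simp only [hA, hB, Set.mem_inter_iff, Set.mem_ofPred_eq]
    constructor
    · rintro ⟨ha, hb⟩ i hi
      rcases i with _ | i
      · exact ha 0 (by omega)
      · exact hb i (by omega)
    · intro h
      exact ⟨fun i hi => h i (by omega), fun i hi => h (i + 1) (by omega)⟩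
  have h4 : P.real (A ∪ B) ≤ maxProb P X n u := by
    rw [← maxProb_shift hX hs 1]
    refine measureReal_mono ?_
    rintro ω (h | h) i hi
    · exact h (i + 1) (by omega)
    · exact h i (by omega)
  have h5 := measureReal_union_add_inter (μ := P) (s := A)
    (measurableSet_maxLe (X := fun i => X (i + 1)) (fun i => hX _) (n + 1) u : MeasurableSet B)
  linarith

lemma maxProb_diff_antitone (hX : ∀ i, Measurable (X i)) (hs : IsStationary P X) (u : ℝ) (j : ℕ) :
    Antitone fun k => maxProb P X k u - maxProb P X (k + j) u := by
  have h1 : Antitone fun k => maxProb P X k u - maxProb P X (k + 1) u :=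
    antitone_nat_of_succ_le fun n => by
      have := maxProb_convex (P := P) hX hs n u
      simp only [add_assoc, Nat.reduceAdd] at this ⊢
      linarith
  refine antitone_nat_of_succ_le fun n => ?_
  have := h1 (Nat.le_add_right n j)
  simp only at this
  rw [show n + 1 + j = n + j + 1 by ring]
  linarith

lemma maxProb_sub_le_one_sub (hX : ∀ i, Measurable (X i)) (hs : IsStationary P X) (u : ℝ)
    (k j : ℕ) : maxProb P X k u - maxProb P X (k + j) u ≤ 1 - maxProb P X j u := by
  simpa [maxProb_zero] using maxProb_diff_antitone (P := P) hX hs u j (Nat.zero_le k)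

/-- By convexity this decrement is the smallest of the first `k + 1`, which together sum to at most
`1`. -/
lemma maxProb_sub_succ_le (hX : ∀ i, Measurable (X i)) (hs : IsStationary P X) (u : ℝ) (k : ℕ) :
    maxProb P X k u - maxProb P X (k + 1) u ≤ 1 / ((k : ℝ) + 1) := by
  have h : ∑ i ∈ Finset.range (k + 1), (maxProb P X k u - maxProb P X (k + 1) u) ≤
      ∑ i ∈ Finset.range (k + 1), (maxProb P X i u - maxProb P X (i + 1) u) :=
    Finset.sum_le_sum fun i hi =>
      maxProb_diff_antitone (P := P) hX hs u 1 (Nat.lt_succ_iff.1 (Finset.mem_range.1 hi))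
  rw [Finset.sum_range_sub' (fun i => maxProb P X i u), Finset.sum_const, Finset.card_range,
    nsmul_eq_mul, maxProb_zero] at h
  have := maxProb_nonneg (P := P) (X := X) (k + 1) u
  rw [le_div_iff₀ (by positivity)]
  push_cast at h
  nlinarith

/-- Changing the number of variables by `j` changes `P(M_k ≤ u)` by at most `j / (k + 1)`. -/
lemma maxProb_sub_le_div (hX : ∀ i, Measurable (X i)) (hs : IsStationary P X) (u : ℝ)
    (k j : ℕ) : maxProb P X k u - maxProb P X (k + j) u ≤ j / ((k : ℝ) + 1) := by
  induction j with
  | zero => simp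
  | succ j ih =>
    have h1 := maxProb_diff_antitone (P := P) hX hs u 1 (Nat.le_add_right k j)
    have h2 := maxProb_sub_succ_le (P := P) hX hs u k
    simp only at h1
    have : ((j + 1 : ℕ) : ℝ) / ((k : ℝ) + 1) = j / ((k : ℝ) + 1) + 1 / ((k : ℝ) + 1) := by
      push_cast; ring
    rw [this, ← add_assoc]
    linarith

/-- For `n ≥ 1`, `u ↦ P(M_n ≤ u)` is a distribution function. -/
lemma maxProb_eq_cdf (hX : ∀ i, Measurable (X i)) {n : ℕ} (hn : 1 ≤ n) :
    ∃ μ : Measure ℝ, IsProbabilityMeasure μ ∧ ∀ u, maxProb P X n u = ProbabilityTheory.cdf μ u := by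
  have hne : (Finset.range n).Nonempty := Finset.nonempty_range_iff.2 (by omega)
  have hm : Measurable ((Finset.range n).sup' hne X) :=
    Finset.measurable_sup' hne fun i _ => hX i
  have : IsProbabilityMeasure (P.map ((Finset.range n).sup' hne X)) :=
    Measure.isProbabilityMeasure_map hm.aemeasurable
  refine ⟨P.map ((Finset.range n).sup' hne X), this, fun u => ?_⟩
  rw [ProbabilityTheory.cdf_eq_real, map_measureReal_apply hm measurableSet_Iic, maxProb_eq]
  congr 1
  ext ω
  simp [Finset.sup'_apply, Finset.sup'_le_iff]

lemma maxProb_isDistributionFunction (hX : ∀ i, Measurable (X i)) {n : ℕ} (hn : 1 ≤ n) :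
    IsDistributionFunction (maxProb P X n) := by
  obtain ⟨μ, _, h⟩ := maxProb_eq_cdf (P := P) hX hn
  rw [show maxProb P X n = ProbabilityTheory.cdf μ from funext h]
  exact ⟨ProbabilityTheory.monotone_cdf μ, (ProbabilityTheory.cdf μ).right_continuous,
    ProbabilityTheory.tendsto_cdf_atBot μ, ProbabilityTheory.tendsto_cdf_atTop μ⟩

end MaxProb

/-! ### Distribution functions and their quantiles. -/

namespace IsDistributionFunction

variable {G : ℝ → ℝ} (hG : IsDistributionFunction G)
include hG

lemma nonneg (x : ℝ) : 0 ≤ G x := hG.monotone.le_of_tendsto hG.tendsto_atBot x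

lemma le_one (x : ℝ) : G x ≤ 1 := hG.monotone.ge_of_tendsto hG.tendsto_atTop x

end IsDistributionFunction

/-- The generalized inverse of a distribution function. -/
noncomputable def quantile (G : ℝ → ℝ) (c : ℝ) : ℝ := sInf {x | c ≤ G x}

/-- Right continuity makes the infimum attained. -/
lemma IsDistributionFunction.quantile_le_iff {G : ℝ → ℝ} (hG : IsDistributionFunction G) {c : ℝ}
    (h0 : 0 < c) (h1 : c < 1) (x : ℝ) : quantile G c ≤ x ↔ c ≤ G x := by
  have hbdd : BddBelow {x | c ≤ G x} := by
    obtain ⟨b, hb⟩ := (hG.tendsto_atBot.eventually_lt_const h0).exists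
    exact ⟨b, fun x hx => le_of_not_gt fun h =>
      (hx.trans (hG.monotone h.le)).not_gt hb⟩
  have hne : {x | c ≤ G x}.Nonempty := by
    obtain ⟨b, hb⟩ := (hG.tendsto_atTop.eventually_const_lt h1).exists
    exact ⟨b, hb.le⟩
  refine ⟨fun h => le_trans ?_ (hG.monotone h), fun h => csInf_le hbdd h⟩
  have hgt : ∀ y ∈ Set.Ioi (quantile G c), c ≤ G y := fun y hy => by
    obtain ⟨z, hz, hzy⟩ := exists_lt_of_csInf_lt hne hy
    exact le_trans hz (hG.monotone hzy.le)
  have := (hG.rightContinuous (quantile G c)).mono Set.Ioi_subset_Ici_self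
  exact ge_of_tendsto this.tendsto (eventually_mem_nhdsWithin.mono hgt)

/-! ### Asymptotics of floors. -/

lemma tendsto_floor_div_atTop {s : ℝ} (hs : 0 < s) :
    Tendsto (fun n : ℕ => ⌊(n : ℝ) / s⌋₊) atTop atTop :=
  tendsto_nat_floor_atTop.comp (tendsto_natCast_atTop_atTop.atTop_div_const hs)

lemma tendsto_div_floor_div {s : ℝ} (hs : 0 < s) :
    Tendsto (fun n : ℕ => (n : ℝ) / ⌊(n : ℝ) / s⌋₊) atTop (𝓝 s) := by
  have h1 : Tendsto (fun n : ℕ => (⌊(n : ℝ) / s⌋₊ : ℝ) / n) atTop (𝓝 s⁻¹) := by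
    refine ((tendsto_nat_floor_mul_div_atTop (inv_pos.2 hs).le).comp
      (tendsto_natCast_atTop_atTop (R := ℝ))).congr fun n => ?_
    simp [div_eq_inv_mul]
  simpa using h1.inv₀ (inv_pos.2 hs).ne'

lemma tendsto_floor_mul_div_floor_div {s t : ℝ} (hs : 0 < s) (ht : 0 < t) :
    Tendsto (fun n : ℕ => (⌊(n : ℝ) * t⌋₊ : ℝ) / ⌊(n : ℝ) / s⌋₊) atTop (𝓝 (s * t)) := by
  have h3 : Tendsto (fun n : ℕ => (⌊(n : ℝ) * t⌋₊ : ℝ) / n) atTop (𝓝 t) := by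
    refine ((tendsto_nat_floor_mul_div_atTop ht.le).comp
      (tendsto_natCast_atTop_atTop (R := ℝ))).congr fun n => ?_
    simp [mul_comm]
  rw [mul_comm]
  refine (h3.mul (tendsto_div_floor_div hs)).congr' ?_
  filter_upwards [eventually_gt_atTop 0] with n hn
  have : (n : ℝ) ≠ 0 := by positivity
  field_simp

/-! ### From mixing conditions to levels on a dense set, and to monotone levels. -/

section Levels

variable {Ω : Type*} [MeasurableSpace Ω] {P : Measure Ω} {X : ℕ → Ω → ℝ} {γ : ℝ} {v : ℕ → ℝ}

lemma LevelsBInf.levelsB (h : LevelsBInf P X γ v) : LevelsB P X γ v :=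
  ⟨h.1, fun _ _ ε hε => (h.2 ε hε).mono fun _ hn p q hp hq _ => hn p q hp hq⟩

variable [IsProbabilityMeasure P]

lemma tendsto_maxProb_sub_of_le_add (hX : ∀ i, Measurable (X i)) (hs : IsStationary P X)
    {k m : ℕ → ℕ} {C : ℕ} (u : ℕ → ℝ) (hk : Tendsto k atTop atTop) (h1 : ∀ n, k n ≤ m n)
    (h2 : ∀ n, m n ≤ k n + C) :
    Tendsto (fun n => maxProb P X (k n) (u n) - maxProb P X (m n) (u n)) atTop (𝓝 0) := by
  have h3 : Tendsto (fun n => (C : ℝ) / ((k n : ℝ) + 1)) atTop (𝓝 0) :=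
    tendsto_const_nhds.div_atTop
      (tendsto_atTop_add_const_right _ _ (tendsto_natCast_atTop_atTop.comp hk))
  refine squeeze_zero (fun n => sub_nonneg.2 (maxProb_antitone _ (h1 n))) (fun n => ?_) h3
  have := maxProb_antitone (P := P) (X := X) (u n) (h2 n)
  have := maxProb_sub_le_div (P := P) hX hs (u n) (k n) C
  simp only at *
  linarith

/-- Blocks are split off one at a time. Each split costs a vanishing error, and earlier errors are
multiplied by a probability. -/
lemma CondB.tendsto_maxProb_mul_sub_pow {T : ℝ} (h : CondB P X T v) {k : ℕ → ℕ}
    (hk : ∀ᶠ n in atTop, 1 ≤ k n) (i : ℕ) (hT : ∀ n, ((i * k n : ℕ) : ℝ) ≤ T * n) :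
    Tendsto (fun n => maxProb P X (i * k n) (v n) - maxProb P X (k n) (v n) ^ i) atTop (𝓝 0) := by
  induction i with
  | zero => simp [maxProb_zero]
  | succ i ih =>
    rcases Nat.eq_zero_or_pos i with rfl | hi
    · simp
    have h1 := ih fun n => le_trans (by gcongr; omega) (hT n)
    have h2 : Tendsto (fun n => maxProb P X ((i + 1) * k n) (v n) -
        maxProb P X (i * k n) (v n) * maxProb P X (k n) (v n)) atTop (𝓝 0) := by
      rw [Metric.tendsto_nhds]
      intro ε hε
      filter_upwards [h (ε / 2) (half_pos hε), hk] with n hn hkn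
      have := hn (i * k n) (k n) (Nat.mul_pos hi hkn) hkn
        (by rw [← Nat.succ_mul]; exact hT n)
      rw [← Nat.succ_mul] at this
      rw [Real.dist_eq, sub_zero]
      exact lt_of_le_of_lt this (half_lt_self hε)
    have h3 : Tendsto (fun n => maxProb P X (k n) (v n) *
        (maxProb P X (i * k n) (v n) - maxProb P X (k n) (v n) ^ i)) atTop (𝓝 0) := by
      refine squeeze_zero_norm (fun n => ?_) (by simpa using h1.norm)
      rw [norm_mul, Real.norm_of_nonneg (maxProb_nonneg _ _)]
      exact mul_le_of_le_one_left (norm_nonneg _) (maxProb_le_one _ _)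
    refine (by simpa using h2.add h3 : Tendsto _ atTop (𝓝 (0 : ℝ))).congr fun n => ?_
    ring

lemma LevelsB.levelsDense (hX : ∀ i, Measurable (X i)) (hs : IsStationary P X) (hγ : 0 < γ)
    (h : LevelsB P X γ v) : LevelsDense P X γ v := by
  refine ⟨{t | ∃ a b : ℕ, 1 ≤ a ∧ 1 ≤ b ∧ t = a / b}, ?_, ?_, ?_⟩
  · rintro t ⟨a, b, ha, hb, rfl⟩
    rw [Set.mem_Ioi]
    positivity
  · intro x hx
    rw [Metric.mem_closure_iff]
    intro ε hε
    obtain ⟨q, hq1, hq2⟩ := exists_rat_btwn (show x < x + ε by linarith)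
    have hq0 : 0 < q := by exact_mod_cast (Set.mem_Ioi.1 hx).trans hq1
    refine ⟨q, ⟨q.num.toNat, q.den, ?_, q.pos, ?_⟩, ?_⟩
    · have := Rat.num_pos.2 hq0
      omega
    · have h1 : ((q.num.toNat : ℤ)) = q.num := Int.toNat_of_nonneg (Rat.num_pos.2 hq0).le
      have h2 : ((q.num.toNat : ℕ) : ℝ) = (q.num : ℝ) := by exact_mod_cast h1
      rw [h2, Rat.cast_def]
    · rw [dist_comm, Real.dist_eq, abs_lt]
      constructor <;> linarith
  · rintro t ⟨a, b, ha, hb, rfl⟩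
    have ha' : (0 : ℝ) < a := by exact_mod_cast ha
    have hb' : (0 : ℝ) < b := by exact_mod_cast hb
    have hk : Tendsto (fun n => n / b) atTop atTop :=
      Nat.tendsto_div_const_atTop (by omega)
    -- Horizon `a + b` accommodates both `a` and `b` blocks of length `n / b`.
    have hB := h.2 (a + b) (by positivity)
    have hT : ∀ i ≤ a + b, ∀ n : ℕ, ((i * (n / b) : ℕ) : ℝ) ≤ ((a : ℝ) + b) * n := by
      intro i hi n
      have : i * (n / b) ≤ (a + b) * n := Nat.mul_le_mul hi (Nat.div_le_self _ _)
      exact_mod_cast this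
    have hk1 := hk.eventually_ge_atTop 1
    have h1 := hB.tendsto_maxProb_mul_sub_pow hk1 b (hT b (by omega))
    have h2 := hB.tendsto_maxProb_mul_sub_pow hk1 a (hT a (by omega))
    have h3 := tendsto_maxProb_sub_of_le_add (P := P) hX hs (k := fun n => b * (n / b))
      (m := fun n => n) (C := b) v (hk.const_mul_atTop' (by omega))
      (fun n => Nat.mul_div_le n b) (fun n => (Nat.lt_mul_div_succ n (by omega)).le)
    have h4 : Tendsto (fun n => maxProb P X (n / b) (v n) ^ b) atTop (𝓝 γ) := by
      refine (by simpa using (h3.sub h1).add h.1 : Tendsto _ atTop (𝓝 γ)).congr fun n => ?_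
      ring
    have h5 : Tendsto (fun n => maxProb P X (n / b) (v n) ^ a) atTop (𝓝 (γ ^ ((a : ℝ) / b))) := by
      refine (h4.rpow_const (p := (a : ℝ) / b) (.inl hγ.ne')).congr fun n => ?_
      rw [← Real.rpow_natCast, ← Real.rpow_mul (maxProb_nonneg _ _),
        mul_div_cancel₀ _ hb'.ne', Real.rpow_natCast]
    have h6 := tendsto_maxProb_sub_of_le_add (P := P) hX hs (k := fun n => a * (n / b))
      (m := fun n : ℕ => ⌊(n : ℝ) * ((a : ℝ) / b)⌋₊) (C := a) v (hk.const_mul_atTop' (by omega))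
      (fun n => by
        refine Nat.le_floor ?_
        have : ((b * (n / b) : ℕ) : ℝ) ≤ n := by exact_mod_cast Nat.mul_div_le n b
        rw [← mul_div_assoc, le_div_iff₀ hb']
        push_cast at this ⊢
        nlinarith)
      (fun n => by
        refine Nat.floor_le_of_le ?_
        have : (n : ℝ) ≤ ((b * (n / b) + b : ℕ) : ℝ) := by
          exact_mod_cast (Nat.lt_mul_div_succ n (by omega)).le
        rw [← mul_div_assoc, div_le_iff₀ hb']
        push_cast at this ⊢
        nlinarith)
    refine (by simpa using (h5.add h2).sub h6 : Tendsto _ atTop (𝓝 (γ ^ ((a : ℝ) / b)))).congr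
      fun n => ?_
    ring

/-- If `P(M_[nt] ≤ v_n) → γ ^ t` on a dense set of `t`, then `P(M_{k_n} ≤ v_{m_n}) → γ ^ t`
whenever `m_n → ∞` and `k_n / m_n → t`. -/
lemma LevelsDense.tendsto_of_ratio (h : LevelsDense P X γ v) (hγ : 0 < γ) {k m : ℕ → ℕ}
    {t : ℝ} (ht : 0 < t) (hm : Tendsto m atTop atTop)
    (hk : Tendsto (fun n => (k n : ℝ) / m n) atTop (𝓝 t)) :
    Tendsto (fun n => maxProb P X (k n) (v (m n))) atTop (𝓝 (γ ^ t)) := by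
  obtain ⟨Q, hQ0, hQ, hlim⟩ := h
  have hcont : Continuous fun x : ℝ => γ ^ x := Real.continuous_const_rpow hγ.ne'
  have hdense : ∀ U : Set ℝ, IsOpen U → (U ∩ Set.Ioi 0).Nonempty → (U ∩ Q).Nonempty := by
    rintro U hU ⟨x, hxU, hx0⟩
    exact mem_closure_iff.1 (hQ hx0) U hU hxU
  have hm0 := hm.eventually_ge_atTop 1
  rw [tendsto_order]
  constructor
  · intro a ha
    -- For `s ∈ Q` slightly above `t`, eventually `k n ≤ ⌊m n * s⌋`, so the known limit at `s`
    -- bounds from below; the upper bound uses `s` slightly below `t`.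
    obtain ⟨s, ⟨hs1, hs2⟩, hsQ⟩ := hdense ({x | a < γ ^ x} ∩ Set.Ioi t)
      ((isOpen_lt continuous_const hcont).inter isOpen_Ioi) (by
        have h1 : ∀ᶠ x in 𝓝[>] t, a < γ ^ x :=
          (hcont.tendsto t).mono_left nhdsWithin_le_nhds |>.eventually_const_lt ha
        obtain ⟨x, hx, hxt⟩ := (h1.and eventually_mem_nhdsWithin).exists
        exact ⟨x, ⟨hx, hxt⟩, ht.trans hxt⟩)
    filter_upwards [hm0, hk.eventually_lt_const hs2,
      ((hlim s hsQ).comp hm).eventually_const_lt hs1] with n hn1 hn2 hn3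
    refine hn3.trans_le (maxProb_antitone _ (Nat.le_floor ?_))
    have : (0 : ℝ) < m n := by exact_mod_cast hn1
    rw [div_lt_iff₀ this] at hn2
    linarith
  · intro a ha
    obtain ⟨s, ⟨hs1, hs2⟩, hsQ⟩ := hdense ({x | γ ^ x < a} ∩ Set.Iio t)
      ((isOpen_lt hcont continuous_const).inter isOpen_Iio) (by
        have h1 : ∀ᶠ x in 𝓝[<] t, γ ^ x < a :=
          (hcont.tendsto t).mono_left nhdsWithin_le_nhds |>.eventually_lt_const ha
        have h2 : ∀ᶠ x in 𝓝[<] t, 0 < x :=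
          nhdsWithin_le_nhds (Ioi_mem_nhds ht)
        obtain ⟨x, ⟨hx, hx0⟩, hxt⟩ := ((h1.and h2).and eventually_mem_nhdsWithin).exists
        exact ⟨x, ⟨hx, hxt⟩, hx0⟩)
    filter_upwards [hm0, hk.eventually_const_lt hs2,
      ((hlim s hsQ).comp hm).eventually_lt_const hs1] with n hn1 hn2 hn3
    refine lt_of_le_of_lt (maxProb_antitone _ (Nat.floor_le_of_le ?_)) hn3
    have : (0 : ℝ) < m n := by exact_mod_cast hn1
    rw [lt_div_iff₀ this] at hn2
    linarith

lemma LevelsDense.tendsto_floor (h : LevelsDense P X γ v) (hγ : 0 < γ) {t : ℝ} (ht : 0 < t) :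
    Tendsto (fun n : ℕ => maxProb P X ⌊(n : ℝ) * t⌋₊ (v n)) atTop (𝓝 (γ ^ t)) := by
  refine h.tendsto_of_ratio hγ ht tendsto_id ?_
  have := (tendsto_nat_floor_mul_div_atTop ht.le).comp (tendsto_natCast_atTop_atTop (R := ℝ))
  refine this.congr fun n => ?_
  simp [mul_comm]

lemma LevelsDense.tendsto_self (h : LevelsDense P X γ v) (hγ : 0 < γ) :
    Tendsto (fun n => maxProb P X n (v n)) atTop (𝓝 γ) := by
  simpa using h.tendsto_floor hγ one_pos

lemma LevelsDense.tendsto_floor_div (h : LevelsDense P X γ v) (hγ : 0 < γ) {s : ℝ} (hs : 0 < s) :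
    Tendsto (fun n : ℕ => maxProb P X n (v ⌊(n : ℝ) / s⌋₊)) atTop (𝓝 (γ ^ s)) :=
  h.tendsto_of_ratio hγ hs (tendsto_floor_div_atTop hs) (tendsto_div_floor_div hs)

/-- The quantiles of the maxima at level `γ` can replace the levels `v_n`. -/
lemma LevelsDense.quantile (hX : ∀ i, Measurable (X i)) (h : LevelsDense P X γ v)
    (hγ0 : 0 < γ) (hγ1 : γ < 1) :
    LevelsDense P X γ (fun n => quantile (maxProb P X n) γ) := by
  have hq : ∀ n, 1 ≤ n → ∀ x, PhantomDF.quantile (maxProb P X n) γ ≤ x ↔ γ ≤ maxProb P X n x :=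
    fun n hn => (maxProb_isDistributionFunction hX hn).quantile_le_iff hγ0 hγ1
  refine ⟨Set.Ioi 0, subset_rfl, subset_closure, fun t ht => ?_⟩
  have ht : 0 < t := ht
  have hcont : Continuous fun s : ℝ => γ ^ (s * t) :=
    (Real.continuous_const_rpow hγ0.ne').comp (continuous_mul_const t)
  have hfl : ∀ s : ℝ, 0 < s → Tendsto (fun n : ℕ => maxProb P X ⌊(n : ℝ) * t⌋₊
      (v ⌊(n : ℝ) / s⌋₊)) atTop (𝓝 (γ ^ (s * t))) :=
    fun s hs => h.tendsto_of_ratio hγ0 (mul_pos hs ht) (tendsto_floor_div_atTop hs)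
      (tendsto_floor_mul_div_floor_div hs ht)
  rw [tendsto_order]
  constructor
  · intro a ha
    -- For `s > 1`, `P(M_n ≤ v_⌊n/s⌋) → γ ^ s < γ` puts `v_⌊n/s⌋` below the quantile; `s < 1` puts
    -- it above. Letting `s` approach `1` squeezes the limit.
    have h1 : ∀ᶠ s in 𝓝[>] (1 : ℝ), a < γ ^ (s * t) :=
      (hcont.tendsto 1).mono_left nhdsWithin_le_nhds |>.eventually_const_lt (by simpa using ha)
    obtain ⟨s, hs, hs1⟩ := (h1.and eventually_mem_nhdsWithin).exists
    have hs1 : 1 < s := hs1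
    have hs0 : 0 < s := one_pos.trans hs1
    filter_upwards [(hfl s hs0).eventually_const_lt hs, (h.tendsto_floor_div hγ0 hs0).eventually_lt_const
      (Real.rpow_lt_self_of_lt_one hγ0 hγ1 hs1), eventually_ge_atTop 1] with n hn1 hn2 hn3
    refine hn1.trans_le (maxProb_mono _ (le_of_lt ?_))
    rw [← not_le, hq n hn3, not_le]
    exact hn2
  · intro a ha
    have h1 : ∀ᶠ s in 𝓝[<] (1 : ℝ), γ ^ (s * t) < a :=
      (hcont.tendsto 1).mono_left nhdsWithin_le_nhds |>.eventually_lt_const (by simpa using ha)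
    have h2 : ∀ᶠ s in 𝓝[<] (1 : ℝ), 0 < s := nhdsWithin_le_nhds (Ioi_mem_nhds one_pos)
    obtain ⟨s, ⟨hs, hs0⟩, hs1⟩ := ((h1.and h2).and eventually_mem_nhdsWithin).exists
    have hs1 : s < 1 := hs1
    filter_upwards [(hfl s hs0).eventually_lt_const hs, (h.tendsto_floor_div hγ0 hs0).eventually_const_lt
      (Real.self_lt_rpow_of_lt_one hγ0 hγ1 hs1), eventually_ge_atTop 1] with n hn1 hn2 hn3
    exact lt_of_le_of_lt (maxProb_mono _ ((hq n hn3 _).2 hn2.le)) hn1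

/-- Index `0` is excluded: the empty maximum makes the quantile a default value. -/
lemma quantile_maxProb_monotoneOn (hX : ∀ i, Measurable (X i)) (hγ0 : 0 < γ) (hγ1 : γ < 1) :
    MonotoneOn (fun n => PhantomDF.quantile (maxProb P X n) γ) (Set.Ici 1) := by
  intro m hm n hn h
  refine ((maxProb_isDistributionFunction hX hm).quantile_le_iff hγ0 hγ1 _).2 ?_
  exact (((maxProb_isDistributionFunction hX hn).quantile_le_iff hγ0 hγ1 _).1 le_rfl).trans
    (maxProb_antitone _ h)

end Levels

/-- Comparison with all levels in `(0, 1)` forces two `[0, 1]`-valued sequences to be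
asymptotically equal. -/
lemma tendsto_sub_zero_of_levels {a b : ℕ → ℝ} (ha : ∀ n, a n ∈ Set.Icc 0 1)
    (hb : ∀ n, b n ∈ Set.Icc 0 1)
    (h1 : ∀ c ∈ Set.Ioo (0 : ℝ) 1, ∀ ε > 0, ∀ᶠ n in atTop, b n ≤ c → a n ≤ c + ε)
    (h2 : ∀ c ∈ Set.Ioo (0 : ℝ) 1, ∀ ε > 0, ∀ᶠ n in atTop, c ≤ b n → c - ε ≤ a n) :
    Tendsto (fun n => a n - b n) atTop (𝓝 0) := by
  rw [Metric.tendsto_nhds]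
  intro ε hε
  obtain ⟨N, hN⟩ := exists_nat_one_div_lt (half_pos hε)
  have hN0 : (0 : ℝ) < N + 1 := by positivity
  -- Only finitely many levels are needed, on a grid of mesh below `ε / 2`. The end cells are
  -- handled by `0 ≤ a n ≤ 1`.
  have hgrid : ∀ᶠ n in atTop, ∀ i ∈ Finset.Ioo 0 (N + 1),
      (b n ≤ i / ((N : ℝ) + 1) → a n ≤ i / ((N : ℝ) + 1) + ε / 2) ∧
      (i / ((N : ℝ) + 1) ≤ b n → i / ((N : ℝ) + 1) - ε / 2 ≤ a n) := by
    rw [eventually_all_finset]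
    intro i hi
    obtain ⟨hi0, hi1⟩ := Finset.mem_Ioo.1 hi
    have hc : (i : ℝ) / ((N : ℝ) + 1) ∈ Set.Ioo (0 : ℝ) 1 := by
      constructor
      · positivity
      · rw [div_lt_one hN0]; exact_mod_cast hi1
    exact (h1 _ hc _ (half_pos hε)).and (h2 _ hc _ (half_pos hε))
  filter_upwards [hgrid] with n hn
  obtain ⟨ha0, ha1⟩ := ha n
  obtain ⟨hb0, hb1⟩ := hb n
  rw [Real.dist_eq, sub_zero, abs_lt]
  constructor
  · obtain ⟨i, hi1, hi2, hi3⟩ : ∃ i : ℕ, i < N + 1 ∧ (i : ℝ) ≤ b n * (N + 1) ∧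
        b n * (N + 1) ≤ i + 1 := by
      rcases hb1.eq_or_lt with h | h
      -- At `b n = 1` the floor would be `N + 1`, off the grid.
      · exact ⟨N, by omega, by rw [h]; linarith, by rw [h]; linarith⟩
      · refine ⟨⌊b n * (N + 1)⌋₊, ?_, Nat.floor_le (by positivity), (Nat.lt_floor_add_one _).le⟩
        rw [Nat.floor_lt (by positivity)]
        push_cast
        nlinarith
    have h3 : b n ≤ i / ((N : ℝ) + 1) + 1 / ((N : ℝ) + 1) := by
      rw [← add_div, le_div_iff₀ hN0]; exact hi3
    rcases Nat.eq_zero_or_pos i with rfl | hi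
    · simp at h3 hN
      linarith
    · have := (hn i (Finset.mem_Ioo.2 ⟨hi, hi1⟩)).2 (by rw [div_le_iff₀ hN0]; exact hi2)
      linarith
  · set i := ⌊b n * (N + 1)⌋₊ + 1 with hi
    have h3 : i / ((N : ℝ) + 1) - 1 / ((N : ℝ) + 1) ≤ b n := by
      rw [← sub_div, div_le_iff₀ hN0, hi]
      push_cast
      linarith [Nat.floor_le (show 0 ≤ b n * (N + 1) by positivity)]
    by_cases h : i < N + 1
    · have := (hn i (Finset.mem_Ioo.2 ⟨by omega, h⟩)).1 (by
        rw [le_div_iff₀ hN0, hi]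
        push_cast
        exact (Nat.lt_floor_add_one _).le)
      linarith
    · have : 1 ≤ (i : ℝ) / ((N : ℝ) + 1) := by
        rw [le_div_iff₀ hN0, one_mul]
        exact_mod_cast not_lt.1 h
      linarith

lemma isDistributionFunction_rpow {γ : ℝ} {g : ℝ → ℝ} (hγ0 : 0 < γ) (hγ1 : γ < 1) (hg : Antitone g)
    (hgc : Continuous g) (hbot : Tendsto g atBot atTop) (htop : Tendsto g atTop (𝓝 0)) :
    IsDistributionFunction fun x => γ ^ g x where
  monotone _ _ h := Real.rpow_le_rpow_of_exponent_ge hγ0 hγ1.le (hg h)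
  rightContinuous _ := ((Real.continuous_const_rpow hγ0.ne').comp hgc).continuousWithinAt
  tendsto_atBot := (tendsto_rpow_atTop_of_base_lt_one γ (by linarith) hγ1).comp hbot
  tendsto_atTop := by
    simpa [Function.comp_def] using ((Real.continuous_const_rpow hγ0.ne').tendsto 0).comp htop

lemma eq_of_forall_notMem_jumpIndices {v : ℕ → ℝ} (hv : MonotoneOn v (Set.Ici 1)) {m q : ℕ} (hm : 1 ≤ m)
    (hq : m ≤ q) (h : ∀ i, m ≤ i → i < q → i ∉ jumpIndices v) : v q = v m := by
  induction q, hq using Nat.le_induction with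
  | base => rfl
  | succ q hq ih =>
    rw [← ih fun i hi hi' => h i hi (by omega)]
    have h1 : 1 ≤ q := hm.trans hq
    have h2 := h q hq (by omega)
    simp only [jumpIndices, Set.mem_ofPred_eq, not_and, not_lt] at h2
    exact le_antisymm (h2 h1) (hv h1 (Nat.le_succ_of_le h1) (Nat.le_succ q))

/-! ### Criterion for `γ ^ g` to be phantom; constancy blocks of the levels. -/

section Exponent

variable {Ω : Type*} [MeasurableSpace Ω] {P : Measure Ω} {X : ℕ → Ω → ℝ} {γ : ℝ} {v : ℕ → ℝ}
  [IsProbabilityMeasure P]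

/-- If `g` is asymptotically `1 / m` at `v m`, then `γ ^ g` is a phantom distribution function. -/
lemma LevelsDense.isPhantom_rpow (h : LevelsDense P X γ v) (hγ0 : 0 < γ) (hγ1 : γ < 1)
    {g : ℝ → ℝ} (hG : IsDistributionFunction fun x => γ ^ g x)
    (hA : ∀ m : ℕ, 1 ≤ m → ∀ x, v m ≤ x → g x ≤ 1 / m)
    (hB : ∀ r : ℝ, 1 < r → ∀ᶠ m : ℕ in atTop, ∀ x < v m, 1 / (r * m) ≤ g x) :
    IsPhantom P X fun x => γ ^ g x := by
  refine ⟨hG, fun u => ?_⟩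
  have hpow : ∀ n : ℕ, (γ ^ g (u n)) ^ n = γ ^ (n * g (u n)) := fun n => by
    rw [← Real.rpow_natCast, ← Real.rpow_mul hγ0.le, mul_comm]
  have hlev : ∀ c ∈ Set.Ioo (0 : ℝ) 1, ∃ t : ℝ, 0 < t ∧ c = γ ^ t := by
    rintro c ⟨hc0, hc1⟩
    refine ⟨Real.logb γ c, Real.logb_pos_of_base_lt_one hγ0 hγ1 hc0 hc1, ?_⟩
    rw [Real.rpow_logb hγ0 hγ1.ne hc0]
  have hcont : Continuous fun s : ℝ => γ ^ s := Real.continuous_const_rpow hγ0.ne'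
  refine tendsto_sub_zero_of_levels (fun n => ⟨maxProb_nonneg _ _, maxProb_le_one _ _⟩)
    (fun n => ⟨pow_nonneg (hG.nonneg _) _, pow_le_one₀ (hG.nonneg _) (hG.le_one _)⟩) ?_ ?_
  · intro c hc ε hε
    obtain ⟨t, ht, rfl⟩ := hlev c hc
    -- If `u n ≥ v_⌊n/s⌋` with `s < t`, then `n * g (u n)` is at most `n / ⌊n/s⌋ → s < t`,
    -- contradicting `γ ^ (n * g (u n)) ≤ γ ^ t`.
    have h1 : ∀ᶠ s in 𝓝[<] t, γ ^ s < γ ^ t + ε :=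
      ((hcont.tendsto t).mono_left nhdsWithin_le_nhds).eventually_lt_const (by linarith)
    have h2 : ∀ᶠ s in 𝓝[<] t, 0 < s := nhdsWithin_le_nhds (Ioi_mem_nhds ht)
    obtain ⟨s, ⟨hs, hs0⟩, hst⟩ := ((h1.and h2).and eventually_mem_nhdsWithin).exists
    filter_upwards [(h.tendsto_floor_div hγ0 hs0).eventually_lt_const hs,
      (tendsto_div_floor_div hs0).eventually_lt_const hst,
      (tendsto_floor_div_atTop hs0).eventually_ge_atTop 1] with n hn1 hn2 hn3 hn
    rw [hpow, Real.rpow_le_rpow_left_iff_of_base_lt_one hγ0 hγ1] at hn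
    refine (maxProb_mono _ (le_of_not_ge fun hu => ?_)).trans hn1.le
    have h3 := mul_le_mul_of_nonneg_left (hA _ hn3 _ hu) (Nat.cast_nonneg (α := ℝ) n)
    rw [mul_one_div] at h3
    linarith
  · intro c hc ε hε
    obtain ⟨t, ht, rfl⟩ := hlev c hc
    have h1 : ∀ᶠ s in 𝓝[>] t, γ ^ t - ε < γ ^ s :=
      ((hcont.tendsto t).mono_left nhdsWithin_le_nhds).eventually_const_lt (by linarith)
    obtain ⟨s, hs, hst⟩ := (h1.and eventually_mem_nhdsWithin).exists
    have hst : t < s := hst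
    have hs0 : 0 < s := ht.trans hst
    -- The slack `r < s / t` absorbs the factor in `hB`, since `n / (r * ⌊n/s⌋) → s / r > t`.
    obtain ⟨r, hr1, hr2⟩ := exists_between ((one_lt_div ht).2 hst)
    have hr0 : 0 < r := one_pos.trans hr1
    have hr3 : r * t < s := (lt_div_iff₀ ht).1 hr2
    filter_upwards [(h.tendsto_floor_div hγ0 hs0).eventually_const_lt hs,
      (tendsto_div_floor_div hs0).eventually_const_lt hr3,
      (tendsto_floor_div_atTop hs0).eventually (hB r hr1)] with n hn1 hn2 hn3 hn
    rw [hpow, Real.rpow_le_rpow_left_iff_of_base_lt_one hγ0 hγ1] at hn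
    refine hn1.le.trans (maxProb_mono _ (le_of_not_gt fun hu => ?_))
    have h3 := mul_le_mul_of_nonneg_left (hn3 _ hu) (Nat.cast_nonneg (α := ℝ) n)
    have h4 : (n : ℝ) * (1 / (r * (⌊(n : ℝ) / s⌋₊ : ℝ))) = n / (⌊(n : ℝ) / s⌋₊ : ℝ) / r := by
      rw [mul_one_div, div_div, mul_comm r]
    have h5 : t < n / (⌊(n : ℝ) / s⌋₊ : ℝ) / r := by
      rw [lt_div_iff₀ hr0]; linarith
    linarith

/-- If `v q = v m` with `q > r * m`, then `P(M_q ≤ v_q)` is near `γ`, yet at most `P(M_⌊rm⌋ ≤ v_m)`,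
which is near `γ ^ r < γ`. -/
lemma LevelsDense.eventually_le_mul (h : LevelsDense P X γ v) (hγ0 : 0 < γ) (hγ1 : γ < 1)
    {r : ℝ} (hr : 1 < r) : ∀ᶠ m : ℕ in atTop, ∀ q : ℕ, m ≤ q → v q = v m → (q : ℝ) ≤ r * m := by
  obtain ⟨c, hc1, hc2⟩ := exists_between (Real.rpow_lt_self_of_lt_one hγ0 hγ1 hr)
  filter_upwards [(h.tendsto_floor hγ0 (one_pos.trans hr)).eventually_lt_const hc1,
    eventually_forall_ge_atTop.2 ((h.tendsto_self hγ0).eventually_const_lt hc2)] with m h1 h2 q hq hv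
  by_contra! hlt
  have h3 : maxProb P X q (v m) ≤ maxProb P X ⌊(m : ℝ) * r⌋₊ (v m) :=
    maxProb_antitone _ (Nat.floor_le_of_le (by linarith))
  have h4 := h2 q hq
  rw [hv] at h4
  linarith

lemma LevelsDense.jumpIndices_infinite (h : LevelsDense P X γ v) (hγ0 : 0 < γ) (hγ1 : γ < 1)
    (hv : MonotoneOn v (Set.Ici 1)) : (jumpIndices v).Infinite := by
  intro hfin
  obtain ⟨N, hN⟩ := hfin.bddAbove
  obtain ⟨m, ⟨h1, h2⟩, h3⟩ := ((h.eventually_le_mul hγ0 hγ1 one_lt_two).and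
    (eventually_ge_atTop 1) |>.and (eventually_gt_atTop N)).exists
  have h4 := h1 (3 * m) (by omega) (eq_of_forall_notMem_jumpIndices hv h2 (by omega)
    fun i hi _ hmem => by have := hN hmem; omega)
  have : (1 : ℝ) ≤ m := by exact_mod_cast h2
  push_cast at h4
  linarith

end Exponent

/-! ### The piecewise linear exponent. -/

section ExponentMono

variable {v : ℕ → ℝ}

lemma jumpIndex_mem (hinf : (jumpIndices v).Infinite) (k : ℕ) : jumpIndex v k ∈ jumpIndices v :=
  Nat.nth_mem_of_infinite hinf k

lemma jumpIndex_pos (hinf : (jumpIndices v).Infinite) (k : ℕ) : 1 ≤ jumpIndex v k :=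
  (jumpIndex_mem hinf k).1

lemma jumpIndex_strictMono (hinf : (jumpIndices v).Infinite) : StrictMono (jumpIndex v) :=
  Nat.nth_strictMono hinf

lemma strictMono_comp_jumpIndex (hv : MonotoneOn v (Set.Ici 1))
    (hinf : (jumpIndices v).Infinite) : StrictMono fun k => v (jumpIndex v k) :=
  strictMono_nat_of_lt_succ fun k => (jumpIndex_mem hinf k).2.trans_le
    (hv (Nat.le_succ_of_le (jumpIndex_pos hinf k)) (jumpIndex_pos hinf (k + 1))
      (jumpIndex_strictMono hinf (Nat.lt_succ_self k)))

/-- The first jump at or after `m` ends the constancy block containing `m`. -/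
lemma exists_jumpIndex_ge (hv : MonotoneOn v (Set.Ici 1)) (hinf : (jumpIndices v).Infinite)
    {m : ℕ} (hm : 1 ≤ m) : ∃ k, m ≤ jumpIndex v k ∧ v (jumpIndex v k) = v m := by
  classical
  have hex : ∃ k, m ≤ jumpIndex v k := ⟨m, (jumpIndex_strictMono hinf).id_le m⟩
  refine ⟨Nat.find hex, Nat.find_spec hex, eq_of_forall_notMem_jumpIndices hv hm
    (Nat.find_spec hex) fun i hi hlt hmem => ?_⟩
  obtain ⟨j, -, hj⟩ := Nat.exists_lt_card_nth_eq (p := fun n => n ∈ jumpIndices v) hmem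
  have hj : jumpIndex v j = i := hj
  exact Nat.find_min hex ((jumpIndex_strictMono hinf).lt_iff_lt.1 (by rw [hj]; exact hlt))
    (by rw [hj]; exact hi)

lemma exponentMono_of_forall_le (hinf : (jumpIndices v).Infinite) {x : ℝ}
    (hx : ∀ n, 1 ≤ n → v n ≤ x) : exponentMono v x = 0 := by
  simp only [exponentMono]
  rw [if_neg (not_lt.2 (hx _ (jumpIndex_pos hinf 0))), if_pos hx]

lemma exponentMono_of_lt {x : ℝ} (hx : x < v (jumpIndex v 0)) :
    exponentMono v x = v (jumpIndex v 0) - x + 1 / (jumpIndex v 0 : ℝ) := by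
  simp only [exponentMono]
  rw [if_pos hx]

lemma exponentMono_of_mem_Ico (hv : MonotoneOn v (Set.Ici 1)) (hinf : (jumpIndices v).Infinite)
    {x : ℝ} {k : ℕ} (h1 : v (jumpIndex v k) ≤ x) (h2 : x < v (jumpIndex v (k + 1))) :
    exponentMono v x = 1 / (jumpIndex v k : ℝ) +
      (1 / (jumpIndex v (k + 1) : ℝ) - 1 / (jumpIndex v k : ℝ)) *
      ((x - v (jumpIndex v k)) / (v (jumpIndex v (k + 1)) - v (jumpIndex v k))) := by
  have hw := strictMono_comp_jumpIndex hv hinf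
  have hs : sSup {j | v (jumpIndex v j) ≤ x} = k := by
    have : {j | v (jumpIndex v j) ≤ x} = Set.Iic k := by
      ext j
      simp only [Set.mem_ofPred_eq, Set.mem_Iic]
      constructor
      · intro h
        exact Nat.lt_succ_iff.1 (hw.lt_iff_lt.1 (h.trans_lt h2))
      · intro h
        exact (hw.monotone h).trans h1
    rw [this, csSup_Iic]
  simp only [exponentMono]
  rw [if_neg (not_lt.2 ((hw.monotone (Nat.zero_le k)).trans h1)),
    if_neg fun h => (h _ (jumpIndex_pos hinf (k + 1))).not_gt h2, hs]

lemma exponentMono_jumpIndex (hv : MonotoneOn v (Set.Ici 1)) (hinf : (jumpIndices v).Infinite)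
    (k : ℕ) : exponentMono v (v (jumpIndex v k)) = 1 / (jumpIndex v k : ℝ) := by
  rw [exponentMono_of_mem_Ico hv hinf le_rfl (strictMono_comp_jumpIndex hv hinf k.lt_succ_self)]
  simp

lemma exponentMono_of_le (hv : MonotoneOn v (Set.Ici 1)) (hinf : (jumpIndices v).Infinite)
    {x : ℝ} (hx : x ≤ v (jumpIndex v 0)) :
    exponentMono v x = v (jumpIndex v 0) - x + 1 / (jumpIndex v 0 : ℝ) := by
  rcases hx.lt_or_eq with h | rfl
  · exact exponentMono_of_lt h
  · rw [exponentMono_jumpIndex hv hinf]; simp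

lemma exponentMono_of_mem_Icc (hv : MonotoneOn v (Set.Ici 1)) (hinf : (jumpIndices v).Infinite)
    {x : ℝ} {k : ℕ} (h1 : v (jumpIndex v k) ≤ x) (h2 : x ≤ v (jumpIndex v (k + 1))) :
    exponentMono v x = 1 / (jumpIndex v k : ℝ) +
      (1 / (jumpIndex v (k + 1) : ℝ) - 1 / (jumpIndex v k : ℝ)) *
      ((x - v (jumpIndex v k)) / (v (jumpIndex v (k + 1)) - v (jumpIndex v k))) := by
  rcases h2.lt_or_eq with h | rfl
  · exact exponentMono_of_mem_Ico hv hinf h1 h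
  · have := strictMono_comp_jumpIndex hv hinf k.lt_succ_self
    rw [exponentMono_jumpIndex hv hinf, div_self (sub_pos.2 this).ne']
    ring

/-- Adjacent closed pieces agree at their common endpoint, so both properties glue by induction. -/
lemma exponentMono_continuousOn_antitoneOn (hv : MonotoneOn v (Set.Ici 1))
    (hinf : (jumpIndices v).Infinite) (k : ℕ) :
    ContinuousOn (exponentMono v) (Set.Iic (v (jumpIndex v k))) ∧
      AntitoneOn (exponentMono v) (Set.Iic (v (jumpIndex v k))) := by
  induction k with
  | zero =>
    have heq : Set.EqOn (exponentMono v)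
        (fun x => v (jumpIndex v 0) - x + 1 / (jumpIndex v 0 : ℝ))
        (Set.Iic (v (jumpIndex v 0))) := fun x hx => exponentMono_of_le hv hinf hx
    refine ⟨ContinuousOn.congr (by fun_prop) heq, AntitoneOn.congr ?_ heq.symm⟩
    intro x _ y _ h
    simp only
    linarith
  | succ k ih =>
    have hw := strictMono_comp_jumpIndex hv hinf k.lt_succ_self
    simp only [Nat.succ_eq_add_one] at hw
    have heq : Set.EqOn (exponentMono v) (fun x => 1 / (jumpIndex v k : ℝ) +
        (1 / (jumpIndex v (k + 1) : ℝ) - 1 / (jumpIndex v k : ℝ)) *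
        ((x - v (jumpIndex v k)) / (v (jumpIndex v (k + 1)) - v (jumpIndex v k))))
        (Set.Icc (v (jumpIndex v k)) (v (jumpIndex v (k + 1)))) :=
      fun x hx => exponentMono_of_mem_Icc hv hinf hx.1 hx.2
    rw [← Set.Iic_union_Icc_eq_Iic hw.le]
    refine ⟨ih.1.union_of_isClosed (ContinuousOn.congr (by fun_prop) heq) isClosed_Iic isClosed_Icc,
      ih.2.union_right (AntitoneOn.congr ?_ heq.symm) isGreatest_Iic (isLeast_Icc hw.le)⟩
    intro x _ y _ h
    have h1 : (1 : ℝ) / (jumpIndex v (k + 1) : ℝ) ≤ 1 / (jumpIndex v k : ℝ) :=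
      one_div_le_one_div_of_le (by exact_mod_cast jumpIndex_pos hinf k)
        (by exact_mod_cast (jumpIndex_strictMono hinf k.lt_succ_self).le)
    have h2 : (x - v (jumpIndex v k)) / (v (jumpIndex v (k + 1)) - v (jumpIndex v k)) ≤
        (y - v (jumpIndex v k)) / (v (jumpIndex v (k + 1)) - v (jumpIndex v k)) :=
      div_le_div_of_nonneg_right (by linarith) (sub_pos.2 hw).le
    simp only
    nlinarith

lemma forall_le_or_exists_lt_jumpIndex (hv : MonotoneOn v (Set.Ici 1))
    (hinf : (jumpIndices v).Infinite) (x : ℝ) :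
    (∀ n, 1 ≤ n → v n ≤ x) ∨ ∃ k, x < v (jumpIndex v k) := by
  by_contra! h
  obtain ⟨⟨n, hn, hx⟩, h⟩ := h
  obtain ⟨k, -, hk⟩ := exists_jumpIndex_ge hv hinf hn
  exact (hk ▸ h k).not_gt hx

lemma exponentMono_nonneg (hv : MonotoneOn v (Set.Ici 1)) (hinf : (jumpIndices v).Infinite)
    (x : ℝ) : 0 ≤ exponentMono v x := by
  rcases forall_le_or_exists_lt_jumpIndex hv hinf x with h | ⟨k, h⟩
  · exact (exponentMono_of_forall_le hinf h).ge
  · have := (exponentMono_continuousOn_antitoneOn hv hinf k).2 (Set.mem_Iic.2 h.le)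
      Set.self_mem_Iic h.le
    rw [exponentMono_jumpIndex hv hinf] at this
    exact le_trans (by positivity) this

lemma exponentMono_antitone (hv : MonotoneOn v (Set.Ici 1)) (hinf : (jumpIndices v).Infinite) :
    Antitone (exponentMono v) := by
  intro x y h
  rcases forall_le_or_exists_lt_jumpIndex hv hinf y with hy | ⟨k, hy⟩
  · rw [exponentMono_of_forall_le hinf hy]
    exact exponentMono_nonneg hv hinf x
  · exact (exponentMono_continuousOn_antitoneOn hv hinf k).2 (h.trans hy.le) hy.le h

lemma exponentMono_le (hv : MonotoneOn v (Set.Ici 1)) (hinf : (jumpIndices v).Infinite)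
    {m : ℕ} (hm : 1 ≤ m) {x : ℝ} (hx : v m ≤ x) : exponentMono v x ≤ 1 / m := by
  obtain ⟨k, hk, hkv⟩ := exists_jumpIndex_ge hv hinf hm
  refine (exponentMono_antitone hv hinf hx).trans ?_
  rw [← hkv, exponentMono_jumpIndex hv hinf]
  exact one_div_le_one_div_of_le (by exact_mod_cast hm) (by exact_mod_cast hk)

lemma exponentMono_continuous (hv : MonotoneOn v (Set.Ici 1)) (hinf : (jumpIndices v).Infinite) :
    Continuous (exponentMono v) := by
  rw [continuous_iff_continuousAt]
  intro x
  rcases forall_le_or_exists_lt_jumpIndex hv hinf x with hx | ⟨k, hx⟩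
  · rw [ContinuousAt, exponentMono_of_forall_le hinf hx, Metric.tendsto_nhds]
    intro ε hε
    obtain ⟨N, hN⟩ := exists_nat_one_div_lt hε
    obtain ⟨k, hk, hkv⟩ := exists_jumpIndex_ge hv hinf (Nat.le_add_left 1 N)
    -- Strict because a further jump occurs after index `N + 1`, and its level is still at most `x`.
    have hlt : v (N + 1) < x := by
      rw [← hkv]
      exact (strictMono_comp_jumpIndex hv hinf k.lt_succ_self).trans_le
        (hx _ (jumpIndex_pos hinf _))
    filter_upwards [Ioi_mem_nhds hlt] with y hy
    have := exponentMono_le hv hinf (Nat.le_add_left 1 N) (le_of_lt hy)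
    rw [Real.dist_eq, sub_zero, abs_of_nonneg (exponentMono_nonneg hv hinf y)]
    push_cast at this
    linarith
  · exact (exponentMono_continuousOn_antitoneOn hv hinf k).1.continuousAt (Iic_mem_nhds hx)

lemma exponentMono_tendsto_atBot (hv : MonotoneOn v (Set.Ici 1))
    (hinf : (jumpIndices v).Infinite) : Tendsto (exponentMono v) atBot atTop := by
  have h : Tendsto (fun x => v (jumpIndex v 0) - x + 1 / (jumpIndex v 0 : ℝ)) atBot atTop :=
    tendsto_atTop_add_const_right _ _
      (tendsto_atTop_add_const_left _ (v (jumpIndex v 0)) tendsto_neg_atBot_atTop)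
  refine h.congr' ?_
  filter_upwards [eventually_le_atBot (v (jumpIndex v 0))] with x hx
  exact (exponentMono_of_le hv hinf hx).symm

lemma exponentMono_tendsto_atTop (hv : MonotoneOn v (Set.Ici 1))
    (hinf : (jumpIndices v).Infinite) : Tendsto (exponentMono v) atTop (𝓝 0) := by
  rw [Metric.tendsto_nhds]
  intro ε hε
  obtain ⟨N, hN⟩ := exists_nat_one_div_lt hε
  filter_upwards [eventually_ge_atTop (v (N + 1))] with y hy
  have := exponentMono_le hv hinf (Nat.le_add_left 1 N) hy
  rw [Real.dist_eq, sub_zero, abs_of_nonneg (exponentMono_nonneg hv hinf y)]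
  push_cast at this
  linarith

lemma jumpIndices_of_strictMonoOn (hv : StrictMonoOn v (Set.Ici 1)) :
    jumpIndices v = Set.Ici 1 := by
  ext n
  simp only [jumpIndices, Set.mem_ofPred_eq, Set.mem_Ici, and_iff_left_iff_imp]
  intro hn
  exact hv hn (Nat.le_succ_of_le hn) n.lt_succ_self

lemma jumpIndex_of_strictMonoOn (hv : StrictMonoOn v (Set.Ici 1)) (k : ℕ) :
    jumpIndex v k = k + 1 := by
  have hset := jumpIndices_of_strictMonoOn hv
  have hinf : (jumpIndices v).Infinite := hset ▸ Set.Ici_infinite 1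
  have hr : Set.range (jumpIndex v) = Set.range (fun k : ℕ => k + 1) := by
    have h1 : Set.range (jumpIndex v) = jumpIndices v := Nat.range_nth_of_infinite hinf
    rw [h1, hset]
    ext n
    simp only [Set.mem_Ici, Set.mem_range]
    exact ⟨fun h => ⟨n - 1, by omega⟩, by rintro ⟨y, rfl⟩; omega⟩
  exact congrFun ((jumpIndex_strictMono hinf).range_inj
    (strictMono_nat_of_lt_succ fun n => by omega) |>.1 hr) k

/-- Every index `n ≥ 1` is a jump, so `p k = k + 1`, and both formulas give the same affine
interpolation. -/
lemma exponentStrict_eq_exponentMono (hv : StrictMonoOn v (Set.Ici 1)) :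
    exponentStrict v = exponentMono v := by
  have hinf : (jumpIndices v).Infinite :=
    jumpIndices_of_strictMonoOn hv ▸ Set.Ici_infinite 1
  have hp := jumpIndex_of_strictMonoOn hv
  funext x
  rcases lt_or_ge x (v 1) with hx | hx
  · rw [exponentMono_of_lt (by rwa [hp]), exponentStrict, if_pos hx, hp]
    norm_num
  by_cases hall : ∀ n, 1 ≤ n → v n ≤ x
  · rw [exponentMono_of_forall_le hinf hall, exponentStrict, if_neg hx.not_gt, if_pos hall]
  obtain ⟨k, hk1, hk2⟩ : ∃ k, v (k + 1) ≤ x ∧ x < v (k + 1 + 1) := by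
    by_contra! hcon
    refine hall fun n hn => ?_
    induction n, hn using Nat.le_induction with
    | base => exact hx
    | succ n hn ih =>
      obtain ⟨j, rfl⟩ := Nat.exists_eq_add_of_le' hn
      exact hcon j ih
  rw [exponentMono_of_mem_Ico hv.monotoneOn hinf (k := k) (by rwa [hp]) (by rwa [hp]), hp, hp]
  have hs : sSup {n | 1 ≤ n ∧ v n ≤ x} = k + 1 := by
    have : {n | 1 ≤ n ∧ v n ≤ x} = Set.Icc 1 (k + 1) := by
      ext j
      simp only [Set.mem_ofPred_eq, Set.mem_Icc, and_congr_right_iff]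
      intro hj
      constructor
      · intro h
        exact Nat.lt_succ_iff.1 ((hv.lt_iff_lt hj (Nat.le_add_left 1 (k + 1))).1 (h.trans_lt hk2))
      · intro h
        exact (hv.monotoneOn hj (Nat.le_add_left 1 k) h).trans hk1
    rw [this, csSup_Icc (by omega)]
  simp only [exponentStrict]
  rw [if_neg hx.not_gt, if_neg hall, hs]
  have hlt : v (k + 1) < v (k + 1 + 1) := hk1.trans_lt hk2
  have hne := (sub_pos.2 hlt).ne'
  push_cast
  have h1 : (k : ℝ) + 1 ≠ 0 := by positivity
  have h2 : (k : ℝ) + 1 + 1 ≠ 0 := by positivity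
  field_simp
  ring

end ExponentMono

lemma LevelsDense.isPhantom_exponentMono {Ω : Type*} [MeasurableSpace Ω] {P : Measure Ω}
    [IsProbabilityMeasure P] {X : ℕ → Ω → ℝ} {γ : ℝ} {v : ℕ → ℝ} (h : LevelsDense P X γ v)
    (hγ0 : 0 < γ) (hγ1 : γ < 1) (hv : MonotoneOn v (Set.Ici 1)) :
    IsPhantom P X (fun x => γ ^ exponentMono v x) ∧ Continuous fun x => γ ^ exponentMono v x := by
  have hinf := h.jumpIndices_infinite hγ0 hγ1 hv
  have hc := exponentMono_continuous hv hinf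
  refine ⟨?_, (Real.continuous_const_rpow hγ0.ne').comp hc⟩
  refine h.isPhantom_rpow hγ0 hγ1
    (isDistributionFunction_rpow hγ0 hγ1 (exponentMono_antitone hv hinf) hc
      (exponentMono_tendsto_atBot hv hinf) (exponentMono_tendsto_atTop hv hinf))
    (fun m hm x hx => exponentMono_le hv hinf hm hx) fun r hr => ?_
  -- Left of `v m`, `g` is at least its value `1 / p k` at the end of the block of `m`, and `p k ≤ r
  -- * m`.
  filter_upwards [h.eventually_le_mul hγ0 hγ1 hr, eventually_ge_atTop 1] with m hm hm1 x hx
  obtain ⟨k, hk, hkv⟩ := exists_jumpIndex_ge hv hinf hm1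
  refine le_trans ?_ (exponentMono_antitone hv hinf hx.le)
  rw [← hkv, exponentMono_jumpIndex hv hinf]
  exact one_div_le_one_div_of_le (by exact_mod_cast jumpIndex_pos hinf k) (hm _ hk hkv)

/-! ### Behaviour at the right end; regularity and quantiles. -/

section RightEnd

variable {G : ℝ → ℝ}

lemma coe_lt_rightEnd {x y : ℝ} (hxy : x < y) (hy : G y < 1) : (x : EReal) < rightEnd G :=
  lt_of_lt_of_le (EReal.coe_lt_coe_iff.2 hxy) (le_sSup (Set.mem_image_of_mem _ hy))

lemma exists_gt_of_lt_rightEnd {a : EReal} (h : a < rightEnd G) : ∃ y : ℝ, a < y ∧ G y < 1 := by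
  obtain ⟨_, ⟨y, hy, rfl⟩, hay⟩ := lt_sSup_iff.1 h
  exact ⟨y, hay, hy⟩

lemma lt_one_of_lt_rightEnd (hG : Monotone G) {x : ℝ} (h : (x : EReal) < rightEnd G) : G x < 1 := by
  obtain ⟨y, hxy, hy⟩ := exists_gt_of_lt_rightEnd h
  exact (hG (EReal.coe_lt_coe_iff.1 hxy).le).trans_lt hy

lemma eventually_lt_rightEnd (G : ℝ → ℝ) : ∀ᶠ x : ℝ in toRightEnd G, (x : EReal) < rightEnd G :=
  tendsto_comap.eventually eventually_mem_nhdsWithin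

lemma eventually_gt_toRightEnd {a : ℝ} (h : (a : EReal) < rightEnd G) :
    ∀ᶠ x in toRightEnd G, a < x :=
  (tendsto_comap.eventually (nhdsWithin_le_nhds (Ioi_mem_nhds h))).mono
    fun _ hx => EReal.coe_lt_coe_iff.1 hx

lemma tendsto_toRightEnd {u : ℕ → ℝ} (h1 : ∀ᶠ n in atTop, (u n : EReal) < rightEnd G)
    (h2 : ∀ a : ℝ, G a < 1 → ∀ᶠ n in atTop, a < u n) : Tendsto u atTop (toRightEnd G) := by
  rw [toRightEnd, tendsto_comap_iff]
  refine tendsto_nhdsWithin_iff.2 ⟨tendsto_order.2 ⟨fun a ha => ?_, fun a ha => ?_⟩, h1⟩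
  · obtain ⟨y, hay, hy⟩ := exists_gt_of_lt_rightEnd ha
    exact (h2 y hy).mono fun n hn => hay.trans (EReal.coe_lt_coe_iff.2 hn)
  · exact h1.mono fun n hn => lt_trans hn ha

lemma IsDistributionFunction.toRightEnd_neBot (hG : IsDistributionFunction G) :
    (toRightEnd G).NeBot := by
  obtain ⟨x, hx⟩ := (hG.tendsto_atBot.eventually_lt_const one_pos).exists
  have hbot : ⊥ < rightEnd G :=
    lt_of_lt_of_le (EReal.bot_lt_coe x) (le_sSup (Set.mem_image_of_mem _ hx))
  rw [toRightEnd, comap_neBot_iff]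
  intro t ht
  obtain ⟨l, hl, hlt⟩ := (mem_nhdsLT_iff_exists_Ioo_subset' hbot).1 ht
  obtain ⟨y, hy1, hy2⟩ := EReal.lt_iff_exists_real_btwn.1 hl
  exact ⟨y, hlt ⟨hy1, hy2⟩⟩

lemma IsDistributionFunction.isRegular_of_continuous (hG : IsDistributionFunction G)
    (hc : Continuous G) : IsRegular G := by
  refine ⟨tendsto_order.2 ⟨fun a ha => ?_, fun a ha => ?_⟩, ?_⟩
  · have hsurj : ∀ c ∈ Set.Ioo (0 : ℝ) 1, ∃ x, G x = c := fun c hcc =>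
      mem_range_of_exists_le_of_exists_ge hc
        ((hG.tendsto_atBot.eventually_lt_const hcc.1).exists.imp fun _ h => h.le)
        ((hG.tendsto_atTop.eventually_const_lt hcc.2).exists.imp fun _ h => h.le)
    obtain ⟨c, hc1, hc2⟩ := exists_between (max_lt ha one_pos)
    -- A second attained value `d ∈ (c, 1)` puts the point with value `c` strictly left of the right
    -- end.
    obtain ⟨d, hd1, hd2⟩ := exists_between hc2
    have hc0 := (le_max_right _ _).trans_lt hc1
    obtain ⟨x, rfl⟩ := hsurj c ⟨hc0, hc2⟩
    obtain ⟨y, rfl⟩ := hsurj d ⟨hc0.trans hd1, hd2⟩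
    filter_upwards [eventually_gt_toRightEnd (coe_lt_rightEnd (hG.monotone.reflect_lt hd1) hd2)]
      with z hz
    exact ((le_max_left _ _).trans_lt hc1).trans_le (hG.monotone hz.le)
  · exact .of_forall fun x => (hG.le_one x).trans_lt ha
  · refine tendsto_const_nhds.congr' ?_
    filter_upwards [eventually_lt_rightEnd G] with x hx
    have := lt_one_of_lt_rightEnd hG.monotone hx
    rw [hc.continuousAt.continuousWithinAt.leftLim_eq, div_self (sub_pos.2 this).ne']

lemma IsDistributionFunction.leftLim_quantile_le (hG : IsDistributionFunction G) {c : ℝ}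
    (h0 : 0 < c) (h1 : c < 1) : Function.leftLim G (quantile G c) ≤ c := by
  refine le_of_tendsto (hG.monotone.tendsto_leftLim _) ?_
  filter_upwards [self_mem_nhdsWithin] with y hy
  exact le_of_not_ge fun h => ((hG.quantile_le_iff h0 h1 y).2 h).not_gt hy

lemma tendsto_natCast_mul_one_sub_rpow_inv {γ : ℝ} (hγ : 0 < γ) :
    Tendsto (fun n : ℕ => (n : ℝ) * (1 - γ ^ (n : ℝ)⁻¹)) atTop (𝓝 (-Real.log γ)) := by
  have h : Tendsto (fun n : ℕ => ((n : ℝ))⁻¹) atTop (𝓝[>] 0) :=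
    tendsto_inv_atTop_nhdsGT_zero.comp tendsto_natCast_atTop_atTop
  refine ((tendsto_rpow_sub_one_log hγ).comp h).neg.congr fun n => ?_
  simp only [Function.comp_apply, inv_inv]
  ring

/-- For a regular `G`, the quantiles at `γ ^ (1 / n)` approach the right end and
`G (v_n) ^ n → γ`. -/
lemma IsRegular.tendsto_quantile (hG : IsDistributionFunction G) (hr : IsRegular G) {γ : ℝ}
    (hγ0 : 0 < γ) (hγ1 : γ < 1) :
    Tendsto (fun n : ℕ => quantile G (γ ^ (n : ℝ)⁻¹)) atTop (toRightEnd G) ∧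
    Tendsto (fun n : ℕ => G (quantile G (γ ^ (n : ℝ)⁻¹)) ^ n) atTop (𝓝 γ) := by
  have hc0 : ∀ n : ℕ, 0 < γ ^ (n : ℝ)⁻¹ := fun n => Real.rpow_pos_of_pos hγ0 _
  have hc1 : ∀ n : ℕ, 1 ≤ n → γ ^ (n : ℝ)⁻¹ < 1 := fun n hn =>
    Real.rpow_lt_one hγ0.le hγ1 (inv_pos.2 (Nat.cast_pos.2 hn))
  have hlt : ∀ n : ℕ, 1 ≤ n → (quantile G (γ ^ (n : ℝ)⁻¹) : EReal) < rightEnd G := by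
    intro n hn
    have := hG.toRightEnd_neBot
    obtain ⟨y, hy1, hy2⟩ := ((hr.tendsto_one.eventually_const_lt (hc1 n hn)).and
      (eventually_lt_rightEnd G)).exists
    exact lt_of_le_of_lt
      (EReal.coe_le_coe_iff.2 ((hG.quantile_le_iff (hc0 n) (hc1 n hn) y).2 hy1.le)) hy2
  have hclim : Tendsto (fun n : ℕ => γ ^ (n : ℝ)⁻¹) atTop (𝓝 1) := by
    simpa [Function.comp_def] using ((Real.continuous_const_rpow hγ0.ne').tendsto 0).comp
      (tendsto_inv_atTop_zero.comp (tendsto_natCast_atTop_atTop (R := ℝ)))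
  have hv : Tendsto (fun n : ℕ => quantile G (γ ^ (n : ℝ)⁻¹)) atTop (toRightEnd G) := by
    refine tendsto_toRightEnd ((eventually_ge_atTop 1).mono hlt) fun a ha => ?_
    filter_upwards [hclim.eventually_const_lt ha, eventually_ge_atTop 1] with n hn hn1
    rw [← not_le, hG.quantile_le_iff (hc0 n) (hc1 n hn1), not_le]
    exact hn
  refine ⟨hv, ?_⟩
  have hratio := hr.tendsto_ratio.comp hv
  set v : ℕ → ℝ := fun n => quantile G (γ ^ (n : ℝ)⁻¹) with hvdef
  set r : ℕ → ℝ := fun n => (1 - Function.leftLim G (v n)) / (1 - G (v n)) with hrdef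
  have hratio : Tendsto r atTop (𝓝 1) := hratio
  -- Upper bound: `G(v_n-) ≤ γ ^ (1 / n)` gives `1 - G(v_n) ≥ (1 - γ ^ (1 / n)) / r n`; then `1 - x
  -- ≤ exp (-x)` and `r n → 1`.
  have hup : Tendsto (fun n : ℕ => Real.exp (-((n : ℝ) * (1 - γ ^ (n : ℝ)⁻¹) / r n))) atTop
      (𝓝 γ) := by
    have h1 := ((tendsto_natCast_mul_one_sub_rpow_inv hγ0).div hratio one_ne_zero).neg
    have h2 := (Real.continuous_exp.tendsto _).comp h1
    simpa [Function.comp_def, Real.exp_log hγ0] using h2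
  refine tendsto_of_tendsto_of_tendsto_of_le_of_le' tendsto_const_nhds hup ?_ ?_
  · filter_upwards [eventually_ge_atTop 1] with n hn
    have h1 : γ ^ (n : ℝ)⁻¹ ≤ G (v n) := (hG.quantile_le_iff (hc0 n) (hc1 n hn) _).1 le_rfl
    calc γ = (γ ^ (n : ℝ)⁻¹) ^ n := (Real.rpow_inv_natCast_pow hγ0.le (by omega)).symm
      _ ≤ G (v n) ^ n := pow_le_pow_left₀ (hc0 n).le h1 n
  · filter_upwards [eventually_ge_atTop 1, hratio.eventually_const_lt one_pos] with n hn hrn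
    have h1 := hG.leftLim_quantile_le (hc0 n) (hc1 n hn)
    have h2 : 0 < 1 - G (v n) := sub_pos.2 (lt_one_of_lt_rightEnd hG.monotone (hlt n hn))
    have h3 : r n * (1 - G (v n)) = 1 - Function.leftLim G (v n) := div_mul_cancel₀ _ h2.ne'
    have h4 : (1 - γ ^ (n : ℝ)⁻¹) / r n ≤ 1 - G (v n) := by
      rw [div_le_iff₀ hrn, mul_comm, h3]
      linarith
    have h5 : G (v n) ≤ Real.exp (-((1 - γ ^ (n : ℝ)⁻¹) / r n)) := by
      have := Real.add_one_le_exp (-((1 - γ ^ (n : ℝ)⁻¹) / r n))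
      linarith
    calc G (v n) ^ n ≤ Real.exp (-((1 - γ ^ (n : ℝ)⁻¹) / r n)) ^ n :=
          pow_le_pow_left₀ (hG.nonneg _) h5 n
      _ = Real.exp (-((n : ℝ) * (1 - γ ^ (n : ℝ)⁻¹) / r n)) := by
          rw [← Real.exp_nat_mul]
          congr 1
          ring

end RightEnd

/-! ### A regular phantom distribution function yields `B_∞`. -/

section Phantom

variable {Ω : Type*} [MeasurableSpace Ω] {P : Measure Ω} {X : ℕ → Ω → ℝ} {γ : ℝ} {G : ℝ → ℝ}

/-- The convergence in the definition of a phantom distribution function is uniform. -/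
lemma IsPhantom.eventually_forall_abs_sub_le (h : IsPhantom P X G) {ε : ℝ} (hε : 0 < ε) :
    ∀ᶠ n in atTop, ∀ u, |maxProb P X n u - G u ^ n| ≤ ε := by
  -- For each `n` pick a violating level if one exists; the hypothesis along this single sequence
  -- then controls all levels.
  have hu : ∀ n, ∃ u : ℝ, |maxProb P X n u - G u ^ n| ≤ ε →
      ∀ w, |maxProb P X n w - G w ^ n| ≤ ε := fun n => by
    by_cases hn : ∀ w, |maxProb P X n w - G w ^ n| ≤ ε
    · exact ⟨0, fun _ => hn⟩
    · obtain ⟨u, hu⟩ := not_forall.1 hn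
      exact ⟨u, fun h' => absurd h' hu⟩
  choose u hu using hu
  filter_upwards [Metric.tendsto_nhds.1 (h.tendsto_sub u) ε hε] with n hn
  rw [Real.dist_eq, sub_zero] at hn
  exact hu n hn.le

variable [IsProbabilityMeasure P]

/-- Both terms lie between `P(M_q ≤ u) - (1 - P(M_p ≤ u))` and `P(M_q ≤ u)`. No mixing is needed,
which settles short blocks. -/
lemma abs_maxProb_add_sub_mul_le (hX : ∀ i, Measurable (X i)) (hs : IsStationary P X) (u : ℝ)
    (p q : ℕ) : |maxProb P X (p + q) u - maxProb P X p u * maxProb P X q u| ≤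
      1 - maxProb P X p u := by
  have h1 := maxProb_sub_le_one_sub (P := P) hX hs u q p
  have h2 := maxProb_antitone (P := P) (X := X) u (Nat.le_add_right q p)
  have h3 := maxProb_nonneg (P := P) (X := X) q u
  have h4 := maxProb_le_one (P := P) (X := X) q u
  have h5 := maxProb_le_one (P := P) (X := X) p u
  simp only at h2
  rw [add_comm q p] at h1 h2
  rw [abs_le]
  constructor <;> nlinarith

lemma IsPhantom.tendsto_maxProb_one (h : IsPhantom P X G) {v : ℕ → ℝ}
    (hv : Tendsto (fun n => G (v n)) atTop (𝓝 1)) (N : ℕ) :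
    Tendsto (fun n => maxProb P X N (v n)) atTop (𝓝 1) := by
  refine tendsto_order.2 ⟨fun a ha => ?_, fun a ha =>
    .of_forall fun n => (maxProb_le_one _ _).trans_lt ha⟩
  -- A fixed `K ≥ N` suffices: `G(v_n) ^ K → 1`, and `P(M_N ≤ v_n) ≥ P(M_K ≤ v_n)`.
  obtain ⟨K, hK1, hK2⟩ := ((h.eventually_forall_abs_sub_le (half_pos (sub_pos.2 ha))).and
    (eventually_ge_atTop N)).exists
  have hpow : Tendsto (fun n => G (v n) ^ K) atTop (𝓝 1) := by simpa using hv.pow K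
  filter_upwards [hpow.eventually_const_lt (show 1 - (1 - a) / 2 < 1 by linarith)] with n hn
  have h1 := (abs_le.1 (hK1 (v n))).1
  have h2 := maxProb_antitone (P := P) (X := X) (v n) hK2
  simp only at h2
  linarith

lemma IsPhantom.condBInf (hX : ∀ i, Measurable (X i)) (hs : IsStationary P X)
    (h : IsPhantom P X G) {v : ℕ → ℝ} (hv : Tendsto (fun n => G (v n)) atTop (𝓝 1)) :
    CondBInf P X v := by
  intro ε hε
  obtain ⟨N, hN⟩ := eventually_atTop.1
    (h.eventually_forall_abs_sub_le (show 0 < ε / 3 by linarith))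
  filter_upwards [(h.tendsto_maxProb_one hv N).eventually_const_lt
    (show 1 - ε < 1 by linarith)] with n hn p q _ _
  have hsmall : ∀ p q, p ≤ N →
      |maxProb P X (p + q) (v n) - maxProb P X p (v n) * maxProb P X q (v n)| ≤ ε := by
    intro p q hp
    have h1 := maxProb_antitone (P := P) (X := X) (v n) hp
    simp only at h1
    linarith [abs_maxProb_add_sub_mul_le (P := P) hX hs (v n) p q]
  rcases le_total p N with hp | hp
  · exact hsmall p q hp
  rcases le_total q N with hq | hq
  · rw [add_comm, mul_comm]
    exact hsmall q p hq
  have h1 := abs_le.1 (hN (p + q) (by omega) (v n))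
  have h2 := abs_le.1 (hN p hp (v n))
  have h3 := abs_le.1 (hN q hq (v n))
  have hG := h.isDistributionFunction
  have h4 : G (v n) ^ p ≤ 1 := pow_le_one₀ (hG.nonneg _) (hG.le_one _)
  have h5 : 0 ≤ G (v n) ^ p := pow_nonneg (hG.nonneg _) _
  have h6 := maxProb_nonneg (P := P) (X := X) q (v n)
  have h7 := maxProb_le_one (P := P) (X := X) q (v n)
  have h8 : |(maxProb P X p (v n) - G (v n) ^ p) * maxProb P X q (v n)| ≤ ε / 3 := by
    rw [abs_mul, abs_of_nonneg h6]
    exact (mul_le_of_le_one_right (abs_nonneg _) h7).trans (abs_le.2 h2)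
  have h9 : |G (v n) ^ p * (maxProb P X q (v n) - G (v n) ^ q)| ≤ ε / 3 := by
    rw [abs_mul, abs_of_nonneg h5]
    exact (mul_le_of_le_one_left (abs_nonneg _) h4).trans (abs_le.2 h3)
  rw [pow_add] at h1
  have h8 := abs_le.1 h8
  have h9 := abs_le.1 h9
  rw [abs_le]
  constructor <;> linarith

lemma IsPhantom.levelsBInf (hX : ∀ i, Measurable (X i)) (hs : IsStationary P X)
    (h : IsPhantom P X G) (hr : IsRegular G) (hγ0 : 0 < γ) (hγ1 : γ < 1) :
    LevelsBInf P X γ fun n => quantile G (γ ^ (n : ℝ)⁻¹) := by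
  obtain ⟨h1, h2⟩ := hr.tendsto_quantile h.isDistributionFunction hγ0 hγ1
  refine ⟨?_, h.condBInf hX hs (hr.tendsto_one.comp h1)⟩
  simpa using (h.tendsto_sub fun n : ℕ => quantile G (γ ^ (n : ℝ)⁻¹)).add h2

end Phantom

end PhantomDF

theorem mainTheorem2 {Ω : Type*} [MeasurableSpace Ω] (P : Measure Ω) [IsProbabilityMeasure P]
    (X : ℕ → Ω → ℝ) (hX : ∀ i, Measurable (X i)) (hstat : PhantomDF.IsStationary P X) :
    List.TFAE
      [∃ G : ℝ → ℝ, PhantomDF.IsPhantom P X G ∧ Continuous G,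
       ∃ G : ℝ → ℝ, PhantomDF.IsPhantom P X G ∧ PhantomDF.IsRegular G,
       ∃ (v : ℕ → ℝ) (γ : ℝ), γ ∈ Set.Ioo 0 1 ∧ PhantomDF.LevelsBInf P X γ v,
       ∃ (v : ℕ → ℝ) (γ : ℝ), γ ∈ Set.Ioo 0 1 ∧ PhantomDF.LevelsB P X γ v,
       ∃ (v : ℕ → ℝ) (γ : ℝ), γ ∈ Set.Ioo 0 1 ∧ PhantomDF.LevelsDense P X γ v] ∧
    ∀ (v : ℕ → ℝ) (γ : ℝ), γ ∈ Set.Ioo 0 1 →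
      (PhantomDF.LevelsBInf P X γ v ∨ PhantomDF.LevelsB P X γ v ∨
        PhantomDF.LevelsDense P X γ v) →
      (StrictMonoOn v (Set.Ici 1) →
        PhantomDF.IsPhantom P X (fun x => γ ^ PhantomDF.exponentStrict v x) ∧
          Continuous (fun x => γ ^ PhantomDF.exponentStrict v x)) ∧
      (MonotoneOn v (Set.Ici 1) →
        (PhantomDF.jumpIndices v).Infinite ∧
        PhantomDF.IsPhantom P X (fun x => γ ^ PhantomDF.exponentMono v x) ∧
          Continuous (fun x => γ ^ PhantomDF.exponentMono v x)) := by
  constructor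
  · tfae_have 1 → 2 := fun ⟨G, hG, hc⟩ =>
      ⟨G, hG, hG.isDistributionFunction.isRegular_of_continuous hc⟩
    tfae_have 2 → 3 := fun ⟨_, hG, hr⟩ =>
      -- Any `γ ∈ (0, 1)` would serve.
      ⟨_, 1 / 2, ⟨by norm_num, by norm_num⟩,
        hG.levelsBInf hX hstat hr (by norm_num) (by norm_num)⟩
    tfae_have 3 → 4 := fun ⟨v, γ, hγ, h⟩ => ⟨v, γ, hγ, h.levelsB⟩
    tfae_have 4 → 5 := fun ⟨v, γ, hγ, h⟩ => ⟨v, γ, hγ, h.levelsDense hX hstat hγ.1⟩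
    -- The given levels need not be monotone; the quantiles of the maxima are.
    tfae_have 5 → 1 := fun ⟨_, _, hγ, h⟩ =>
      ⟨_, (h.quantile hX hγ.1 hγ.2).isPhantom_exponentMono hγ.1 hγ.2
        (PhantomDF.quantile_maxProb_monotoneOn hX hγ.1 hγ.2)⟩
    tfae_finish
  · intro v γ hγ h
    have hd : PhantomDF.LevelsDense P X γ v := by
      rcases h with h | h | h
      · exact h.levelsB.levelsDense hX hstat hγ.1
      · exact h.levelsDense hX hstat hγ.1
      · exact h
    refine ⟨fun hv => ?_, fun hv => ⟨hd.jumpIndices_infinite hγ.1 hγ.2 hv,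
      hd.isPhantom_exponentMono hγ.1 hγ.2 hv⟩⟩
    rw [PhantomDF.exponentStrict_eq_exponentMono hv]
    exact hd.isPhantom_exponentMono hγ.1 hγ.2 hv.monotoneOn
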